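/- Let $(\mathcal M,\rho)$ be a pseudometric space, where $\rho:\mathcal M\times\mathcal M\to[0,+\infty]$ satisfies $\rho(x,x)=0$, $\rho(x,y)=\rho(y,x)$ and $\rho(x,y)\le\rho(x,z)+\rho(z,y)$ (the values $\rho(x,y)=0$ for $x\neq y$, and $\rho(x,y)=+\infty$, are allowed). Let $X$ be a two-dimensional real Banach space with closed unit ball $B_X$, let $rB_X=\{v\in X:\|v\|\le r\}$ for $r\in[0,+\infty]$ (so that $0\,B_X=\{0\}$ and $(+\infty)B_X=X$), and let $\mathcal K(X)$ be the family of all non-empty compact convex subsets of $X$. A Lipschitz selection of a map $F:\mathcal M\to\mathcal K(X)$ is a map $f:\mathcal M\to X$ with $f(x)\in F(x)$ for all $x\in\mathcal M$ such that $$\|f\|_{\mathrm{Lip}}=\inf\{\lambda>0:\ \|f(x)-f(y)\|\le\lambda\rho(x,y)\ \text{for all}\ x,y\in\mathcal M\}$$ is finite (the set on the right is non-empty). Let $|F|$ be the infimum of $\|f\|_{\mathrm{Lip}}$ over all Lipschitz selections $f$ of $F$. Then $F:\mathcal M\to\mathcal K(X)$ has a Lipschitz selection if and only if there exists a constant $\lambda>0$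 such that for every $x\in\mathcal M$ $$\bigcap_{y,y'\in\mathcal M}\Big\{\big(F(y)\cap[F(y')+\lambda\rho(y',y)B_X]\big)+\lambda\rho(x,y)B_X\Big\}\neq\emptyset,\qquad(*)$$ where $+$ denotes the Minkowski sum. Furthermore, in this case $$\inf\lambda\ \le\ |F|\ \le\ \gamma\,\inf\lambda,$$ where the infimum is taken over all $\lambda>0$ such that $(*)$ holds for every $x\in\mathcal M$, and where $\gamma=12$ for an arbitrary two-dimensional Banach space $X$, and $\gamma=8$ if $X=\ell_\infty^2$, that is, $\mathbb R^2$ with the norm $\max(|x_1|,|x_2|)$. -/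

import Mathlib

open scoped ENNReal Pointwise

noncomputable section

namespace LipSel

/-- The family of all non-empty compact convex finite-dimensional subsets of `X`. -/
def compactConvexFamily (X : Type*) [NormedAddCommGroup X] [NormedSpace ℝ X] : Set (Set X) :=
  {K | K.Nonempty ∧ IsCompact K ∧ Convex ℝ K ∧ FiniteDimensional ℝ (vectorSpan ℝ K)}

/-- The dilate `r B_X` of the closed unit ball, for `r ∈ [0, ∞]`; thus `0 B_X = {0}` and
`∞ B_X = X`. -/
def unitBallMul (X : Type*) [NormedAddCommGroup X] (r : ℝ≥0∞) : Set X :=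
  Metric.closedEBall (0 : X) r

theorem unitBallMul_top (X : Type*) [NormedAddCommGroup X] :
    unitBallMul X ⊤ = Set.univ := by
  ext v
  simp [unitBallMul]

theorem unitBallMul_ofReal (X : Type*) [NormedAddCommGroup X] [NormedSpace ℝ X]
    {r : ℝ} (hr : 0 ≤ r) :
    unitBallMul X (ENNReal.ofReal r) = r • Metric.closedBall (0 : X) 1 := by
  rw [smul_unitClosedBall_of_nonneg hr, unitBallMul, Metric.closedEBall_ofReal hr]

section

variable {M X : Type*} [PseudoEMetricSpace M] [NormedAddCommGroup X]

/-- The constants `l > 0` with `‖f x - f y‖ ≤ l * ρ(x, y)` for all `x, y`, where `ρ = edist` takes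
values in `[0, ∞]`. -/
def lipConstants (f : M → X) : Set ℝ :=
  {l | 0 < l ∧ ∀ x y, ENNReal.ofReal ‖f x - f y‖ ≤ ENNReal.ofReal l * edist x y}

/-- The Lipschitz seminorm of a Lipschitz map `f`. -/
def lipSeminorm (f : M → X) : ℝ := sInf (lipConstants f)

/-- `f` is a Lipschitz selection of the set-valued map `F`. -/
def IsLipschitzSelection (F : M → Set X) (f : M → X) : Prop :=
  (∀ x, f x ∈ F x) ∧ (lipConstants f).Nonempty

/-- `|F|`: the infimum of the Lipschitz seminorms of the Lipschitz selections of `F`. -/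
def selectionNorm (F : M → Set X) : ℝ :=
  sInf {s | ∃ f, IsLipschitzSelection F f ∧ s = lipSeminorm f}

/-- The intersection over all `y, y'` of the sets
`(F y ∩ (F y' + l ρ(y', y) B_X)) + l ρ(x, y) B_X`. -/
def criterionSet (F : M → Set X) (l : ℝ) (x : M) : Set X :=
  ⋂ (y : M) (y' : M),
    ((F y ∩ (F y' + unitBallMul X (ENNReal.ofReal l * edist y' y)))
      + unitBallMul X (ENNReal.ofReal l * edist x y))

/-- The constants `l > 0` for which `criterionSet F l x` is non-empty for every `x`. -/
def admissibleConstants (F : M → Set X) : Set ℝ :=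
  {l | 0 < l ∧ ∀ x, (criterionSet F l x).Nonempty}

end

end LipSel

end

open scoped ENNReal Pointwise

namespace LipSel

/-! A selection `f` with constant `l` puts `f x` itself in every set of the criterion, which gives
necessity and the lower bound.

For the converse, absorb `l` into the metric, `d = l ρ`, and map `X` linearly to the plane with the
uniform norm, with distortion at most 2. There let `K x ⊆ F x` be the intersection over `z` of the
neighbourhoods of `F z` of radii `3 d(x, z)` (`refinement`). By the criterion and Helly's theorem,
the coordinate projections of the sets `K x` are intervals admitting 1-Lipschitz selections
(`exists_coordinate_selection`). These form a point `g x` of the rectangular hull of `K x`, and `f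
x` is a point of `K x` nearest to `g x`.

The displacement from `g x` to `f x` is a diagonal vector `δ (σ, τ)`, and every bound below `δ` is
witnessed by a single neighbourhood (`exists_corner`). Such a witness at `x` survives at `y` with
loss `4 d(x, y)`, so displacements vary by at most that much. This yields the constant 1 + 4 = 5 in
the uniform plane and 2 * 5 = 10 in `X`, within the stated 8 and 12. -/

/-! ### Selections of intervals, and Helly's theorem in the plane. -/

/-- McShane's formula: `g x` is the supremum of `l y - d(x, y)` over `y` at finite distance.
Infinite distances are excluded throughout because `toReal` sends `⊤` to 0. -/
theorem exists_interval_selection {M : Type*} (d : M → M → ℝ≥0∞) (d_self : ∀ x, d x x = 0)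
    (d_comm : ∀ x y, d x y = d y x) (d_tri : ∀ x y z, d x z ≤ d x y + d y z) (l r : M → ℝ)
    (h : ∀ x y, d x y ≠ ⊤ → l y ≤ r x + (d x y).toReal) :
    ∃ g : M → ℝ, (∀ x, l x ≤ g x) ∧ (∀ x, g x ≤ r x) ∧
      ∀ x y, d x y ≠ ⊤ → |g x - g y| ≤ (d x y).toReal := by
  let S : M → Set ℝ := fun x => {t | ∃ y, d x y ≠ ⊤ ∧ t = l y - (d x y).toReal}
  have hub : ∀ x, ∀ t ∈ S x, t ≤ r x := by
    rintro x t ⟨y, hy, rfl⟩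
    linarith [h x y hy]
  have hbdd : ∀ x, BddAbove (S x) := fun x => ⟨r x, hub x⟩
  have hmem : ∀ x, l x ∈ S x := fun x => ⟨x, by simp [d_self], by simp [d_self]⟩
  have key : ∀ x y, d x y ≠ ⊤ → sSup (S x) ≤ sSup (S y) + (d x y).toReal := by
    intro x y hxy
    refine csSup_le ⟨_, hmem x⟩ ?_
    rintro t ⟨z, hz, rfl⟩
    have hle : d y z ≤ d x y + d x z := by
      rw [d_comm x y]; exact d_tri y x z
    have hyz : d y z ≠ ⊤ := ne_top_of_le_ne_top (ENNReal.add_ne_top.2 ⟨hxy, hz⟩) hle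
    have h1 : l z - (d y z).toReal ≤ sSup (S y) := le_csSup (hbdd y) ⟨z, hyz, rfl⟩
    have h2 := ENNReal.toReal_mono (ENNReal.add_ne_top.2 ⟨hxy, hz⟩) hle
    rw [ENNReal.toReal_add hxy hz] at h2
    linarith
  refine ⟨fun x => sSup (S x), fun x => le_csSup (hbdd x) (hmem x),
    fun x => csSup_le ⟨_, hmem x⟩ (hub x), fun x y hxy => ?_⟩
  have h1 := key x y hxy
  have h2 := key y x (by rwa [d_comm])
  rw [d_comm y x] at h2
  rw [abs_le]
  constructor <;> linarith

theorem inter_iInter_nonempty_of_helly {ι : Type*} (A : ι → Set (ℝ × ℝ)) (S : Set (ℝ × ℝ))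
    (hA : ∀ i, Convex ℝ (A i)) (hAc : ∀ i, IsClosed (A i)) (i₀ : ι) (h₀ : IsCompact (A i₀))
    (hS : Convex ℝ S) (hSc : IsClosed S) (hne : (⋂ i, A i).Nonempty)
    (hpair : ∀ i j, (A i ∩ A j ∩ S).Nonempty) : (S ∩ ⋂ i, A i).Nonempty := by
  classical
  have hfin : ∀ s : Finset ι, (S ∩ ⋂ i ∈ s, A i).Nonempty := by
    intro s
    let B : Option ι → Set (ℝ × ℝ) := fun o => o.elim S A
    have hB : (⋂ o ∈ Finset.insertNone s, B o).Nonempty := by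
      refine Convex.helly_theorem' (𝕜 := ℝ) ?_ ?_
      · rintro (_ | i) _
        · exact hS
        · exact hA i
      · intro I _ hI
        have hcard : I.card ≤ 3 := by simpa using hI
        -- Three members of the family are either `S` with at most two of the `A i`, covered by
        -- `hpair`, or only sets `A i`, which share a point by `hne`.
        by_cases hn : none ∈ I
        · have hJ : (Finset.eraseNone I).card ≤ 2 := by
            have : (Finset.eraseNone I).card = I.card - 1 := by
              rw [Finset.card_eraseNone_of_mem hn]
            omega
          have hsub : ∀ i, some i ∈ I → i ∈ Finset.eraseNone I := by simp
          have : ∃ i j, ∀ k ∈ Finset.eraseNone I, k = i ∨ k = j := by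
            generalize Finset.eraseNone I = J at hJ
            interval_cases hc : J.card
            · rw [Finset.card_eq_zero] at hc
              exact ⟨i₀, i₀, by simp [hc]⟩
            · obtain ⟨a, rfl⟩ := Finset.card_eq_one.1 hc
              exact ⟨a, a, by simp⟩
            · obtain ⟨a, b, _, rfl⟩ := Finset.card_eq_two.1 hc
              exact ⟨a, b, by simp⟩
          obtain ⟨i, j, hij⟩ := this
          obtain ⟨u, ⟨hi, hj⟩, hu⟩ := hpair i j
          refine ⟨u, Set.mem_iInter₂.2 ?_⟩
          rintro (_ | k) hk
          · exact hu
          · rcases hij k (hsub k hk) with rfl | rfl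
            · exact hi
            · exact hj
        · obtain ⟨u, hu⟩ := hne
          refine ⟨u, Set.mem_iInter₂.2 ?_⟩
          rintro (_ | k) hk
          · exact absurd hk hn
          · exact Set.mem_iInter.1 hu k
    obtain ⟨u, hu⟩ := hB
    rw [Set.mem_iInter₂] at hu
    exact ⟨u, hu none (by simp), Set.mem_iInter₂.2 fun i hi => hu (some i) (by simpa using hi)⟩
  have hK : IsCompact (A i₀ ∩ S) := h₀.inter_right hSc
  obtain ⟨u, ⟨_, hu⟩, hu'⟩ := hK.inter_iInter_nonempty A hAc fun s => by
    obtain ⟨u, hu, hu'⟩ := hfin (insert i₀ s)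
    rw [Set.mem_iInter₂] at hu'
    exact ⟨u, ⟨hu' i₀ (by simp), hu⟩, Set.mem_iInter₂.2 fun i hi => hu' i (by simp [hi])⟩
  exact ⟨u, hu, hu'⟩

/-! ### Separation from squares, and nearest points in the uniform norm. -/

/-- A convex set disjoint from an open square is separated from it, with the quantitative bound
given by the support function of the square. -/
theorem exists_separation {A : Set (ℝ × ℝ)} (hA : Convex ℝ A) (hne : A.Nonempty) {g : ℝ × ℝ}
    {r : ℝ} (hr : 0 < r) (hd : ∀ u ∈ A, r ≤ dist u g) :
    ∃ p q : ℝ, 0 < |p| + |q| ∧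
      ∀ u ∈ A, (|p| + |q|) * r ≤ p * (u.1 - g.1) + q * (u.2 - g.2) := by
  obtain ⟨f, c, h1, h2⟩ := geometric_hahn_banach_open (convex_ball g r) Metric.isOpen_ball hA
    (Set.disjoint_left.2 fun u hu hu' => absurd (hd u hu') (not_le.2 (Metric.mem_ball.1 hu)))
  have hf : ∀ u : ℝ × ℝ, f u = f (1, 0) * u.1 + f (0, 1) * u.2 := by
    intro u
    have : u = u.1 • ((1, 0) : ℝ × ℝ) + u.2 • ((0, 1) : ℝ × ℝ) := by ext <;> simp
    conv_lhs => rw [this]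
    simp only [map_add, map_smul, smul_eq_mul]
    ring
  set p := f (1, 0)
  set q := f (0, 1)
  have hg := h1 g (Metric.mem_ball_self hr)
  refine ⟨p, q, ?_, fun u hu => ?_⟩
  · by_contra hcon
    have hp : p = 0 := abs_eq_zero.1 (by linarith [abs_nonneg p, abs_nonneg q])
    have hq : q = 0 := abs_eq_zero.1 (by linarith [abs_nonneg p, abs_nonneg q])
    obtain ⟨u, hu⟩ := hne
    have := h2 u hu
    rw [hf, hp, hq] at this hg
    linarith
  · have hu2 := h2 u hu
    rw [hf] at hu2
    have hsign : ∀ t : ℝ, ∃ s : ℝ, |s| ≤ 1 ∧ t * s = |t| := by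
      intro t
      rcases le_total 0 t with h | h
      · exact ⟨1, by simp, by rw [abs_of_nonneg h, mul_one]⟩
      · exact ⟨-1, by simp, by rw [abs_of_nonpos h]; ring⟩
    obtain ⟨s, hs, hps⟩ := hsign p
    obtain ⟨s', hs', hqs⟩ := hsign q
    -- The square is open, so its extremal corner is only approached: test at scale `t < r`, then
    -- let `t` tend to `r`.
    have hlt : ∀ t : ℝ, 0 < t → t < r → (|p| + |q|) * t ≤ p * (u.1 - g.1) + q * (u.2 - g.2) := by
      intro t ht htr
      have hb : (g.1 + t * s, g.2 + t * s') ∈ Metric.ball g r := by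
        rw [Metric.mem_ball, Prod.dist_eq, max_lt_iff, Real.dist_eq, Real.dist_eq]
        simp only [add_sub_cancel_left, abs_mul, abs_of_pos ht]
        constructor <;> nlinarith
      have := h1 _ hb
      rw [hf] at this
      simp only at this
      have e : (|p| + |q|) * t = t * (p * s) + t * (q * s') := by rw [hps, hqs]; ring
      linarith [e]
    have hn : 0 ≤ |p| + |q| := by positivity
    refine le_of_forall_pos_le_add fun ε hε => ?_
    have hη : 0 < min (r / 2) (ε / (|p| + |q| + 1)) := by positivity
    have := hlt (r - min (r / 2) (ε / (|p| + |q| + 1)))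
      (by linarith [min_le_left (r / 2) (ε / (|p| + |q| + 1))]) (by linarith)
    have h3 : (|p| + |q|) * min (r / 2) (ε / (|p| + |q| + 1)) ≤ ε := by
      calc _ ≤ (|p| + |q| + 1) * (ε / (|p| + |q| + 1)) :=
            mul_le_mul (by linarith) (min_le_right _ _) hη.le (by linarith)
        _ = ε := by field_simp
    linarith

/-- If three points of a convex set surround `c`, in the sense that `s` is below and to the left of
`c`, while `L` and `D` are on the two other sides and beyond a line of negative slope, then `c`
belongs to the set. Coordinates are reflected by the signs `σ`, `τ`. -/
theorem corner_mem {A : Set (ℝ × ℝ)} (hA : Convex ℝ A) {s L D c : ℝ × ℝ} (hs : s ∈ A)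
    (hL : L ∈ A) (hD : D ∈ A) {σ τ a b : ℝ} (hσ : σ ≠ 0) (hτ : τ ≠ 0) (ha : 0 < a) (hb : 0 < b)
    (hs1 : σ * (s.1 - c.1) ≤ 0) (hs2 : τ * (s.2 - c.2) ≤ 0)
    (hL1 : σ * (L.1 - c.1) ≤ 0) (hD2 : τ * (D.2 - c.2) ≤ 0)
    (hLa : 0 < a * (σ * (L.1 - c.1)) + b * (τ * (L.2 - c.2)))
    (hDa : 0 < a * (σ * (D.1 - c.1)) + b * (τ * (D.2 - c.2))) : c ∈ A := by
  set s1 := -(σ * (s.1 - c.1)) with hs1'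
  set s2 := -(τ * (s.2 - c.2)) with hs2'
  set l1 := -(σ * (L.1 - c.1)) with hl1'
  set l2 := τ * (L.2 - c.2) with hl2'
  set d1 := σ * (D.1 - c.1) with hd1'
  set d2 := -(τ * (D.2 - c.2)) with hd2'
  have p1 : 0 ≤ s1 := by linarith
  have p2 : 0 ≤ s2 := by linarith
  have p3 : 0 ≤ l1 := by linarith
  have p4 : 0 ≤ d2 := by linarith
  have q1 : a * l1 < b * l2 := by linarith
  have q2 : b * d2 < a * d1 := by linarith
  have p5 : 0 < l2 := by
    by_contra hcon
    nlinarith [mul_nonneg ha.le p3]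
  have p6 : 0 < d1 := by
    by_contra hcon
    nlinarith [mul_nonneg hb.le p4]
  have hw : 0 < l2 * d1 - l1 * d2 := by
    have h1 : (a * l1) * (b * d2) < (b * l2) * (a * d1) :=
      mul_lt_mul'' q1 q2 (by positivity) (by positivity)
    have h2 : 0 < (a * b) * (l2 * d1 - l1 * d2) := by nlinarith
    exact pos_of_mul_pos_right h2 (by positivity)
  have hwL : 0 ≤ s1 * d2 + s2 * d1 := by positivity
  have hwD : 0 ≤ s1 * l2 + s2 * l1 := by positivity
  -- Unnormalised barycentric coordinates of `c` in the triangle `s`, `L`, `D`, given by Cramer's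
  -- rule.
  set w := l2 * d1 - l1 * d2 with hw'
  set wL := s1 * d2 + s2 * d1 with hwL'
  set wD := s1 * l2 + s2 * l1 with hwD'
  have hW : 0 < w + wL + wD := by linarith
  have e1 : w * (s.1 - c.1) + wL * (L.1 - c.1) + wD * (D.1 - c.1) = 0 := by
    have : σ * (w * (s.1 - c.1) + wL * (L.1 - c.1) + wD * (D.1 - c.1)) = 0 := by
      have : σ * (w * (s.1 - c.1) + wL * (L.1 - c.1) + wD * (D.1 - c.1))
        = w * (-s1) + wL * (-l1) + wD * d1 := by rw [hs1', hl1', hd1']; ring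
      rw [this, hw', hwL', hwD']; ring
    exact (mul_eq_zero.1 this).resolve_left hσ
  have e2 : w * (s.2 - c.2) + wL * (L.2 - c.2) + wD * (D.2 - c.2) = 0 := by
    have : τ * (w * (s.2 - c.2) + wL * (L.2 - c.2) + wD * (D.2 - c.2)) = 0 := by
      have : τ * (w * (s.2 - c.2) + wL * (L.2 - c.2) + wD * (D.2 - c.2))
        = w * (-s2) + wL * l2 + wD * (-d2) := by rw [hs2', hl2', hd2']; ring
      rw [this, hw', hwL', hwD']; ring
    exact (mul_eq_zero.1 this).resolve_left hτ
  have hc : (w / (w + wL + wD)) • s + (wL / (w + wL + wD)) • L + (wD / (w + wL + wD)) • D = c := by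
    ext
    · simp only [Prod.fst_add, Prod.smul_fst, smul_eq_mul]
      field_simp
      linarith
    · simp only [Prod.snd_add, Prod.smul_snd, smul_eq_mul]
      field_simp
      linarith
  rw [← hc]
  have := hA.sum_mem (t := Finset.univ)
    (w := ![w / (w + wL + wD), wL / (w + wL + wD), wD / (w + wL + wD)]) (z := ![s, L, D])
    (by intro i _; fin_cases i <;> simp <;> positivity)
    (by simp [Fin.sum_univ_three]; field_simp)
    (by intro i _; fin_cases i <;> simpa)
  simpa [Fin.sum_univ_three] using this

theorem le_of_forall_pos_lt {a c : ℝ} (ha : 0 < a) (h : ∀ r, 0 < r → r < a → r ≤ c) : a ≤ c := by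
  refine le_of_forall_lt_imp_le_of_dense fun r hr => ?_
  rcases le_or_gt r 0 with h0 | h0
  · linarith [h (a / 2) (by linarith) (by linarith)]
  · exact h r h0 hr

/-- A point of the smallest coordinate rectangle containing `K`. -/
def InRectHull (K : Set (ℝ × ℝ)) (g : ℝ × ℝ) : Prop :=
  (∃ u ∈ K, u.1 ≤ g.1) ∧ (∃ u ∈ K, g.1 ≤ u.1) ∧ (∃ u ∈ K, u.2 ≤ g.2) ∧ ∃ u ∈ K, g.2 ≤ u.2

theorem InRectHull.exists_mul_fst {K : Set (ℝ × ℝ)} {g : ℝ × ℝ} (h : InRectHull K g) (σ : ℝ) :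
    ∃ u ∈ K, σ * (u.1 - g.1) ≤ 0 := by
  rcases le_total 0 σ with hσ | hσ
  · obtain ⟨u, hu, hu'⟩ := h.1
    exact ⟨u, hu, mul_nonpos_of_nonneg_of_nonpos hσ (by linarith)⟩
  · obtain ⟨u, hu, hu'⟩ := h.2.1
    exact ⟨u, hu, mul_nonpos_of_nonpos_of_nonneg hσ (by linarith)⟩

theorem InRectHull.exists_mul_snd {K : Set (ℝ × ℝ)} {g : ℝ × ℝ} (h : InRectHull K g) (σ : ℝ) :
    ∃ u ∈ K, σ * (u.2 - g.2) ≤ 0 := by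
  rcases le_total 0 σ with hσ | hσ
  · obtain ⟨u, hu, hu'⟩ := h.2.2.1
    exact ⟨u, hu, mul_nonpos_of_nonneg_of_nonpos hσ (by linarith)⟩
  · obtain ⟨u, hu, hu'⟩ := h.2.2.2
    exact ⟨u, hu, mul_nonpos_of_nonpos_of_nonneg hσ (by linarith)⟩

theorem exists_sign (p : ℝ) : ∃ σ : ℝ, (σ = 1 ∨ σ = -1) ∧ p = |p| * σ := by
  rcases le_total 0 p with h | h
  · exact ⟨1, Or.inl rfl, by rw [abs_of_nonneg h, mul_one]⟩
  · exact ⟨-1, Or.inr rfl, by rw [abs_of_nonpos h]; ring⟩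

theorem abs_sub_le_of_dist_le {u g : ℝ × ℝ} {r : ℝ} (h : dist u g ≤ r) :
    |u.1 - g.1| ≤ r ∧ |u.2 - g.2| ≤ r := by
  rw [Prod.dist_eq, max_le_iff] at h
  exact h

theorem sign_mul_le {σ t r : ℝ} (hσ : σ = 1 ∨ σ = -1) (h : |t| ≤ r) : σ * t ≤ r := by
  rw [abs_le] at h
  rcases hσ with rfl | rfl <;> linarith

/-- The nearest point of an intersection of convex sets to a point `g` of its rectangular hull is
a corner `g + δ (σ, τ)` of a square, and the distance is detected by the single sets. -/
theorem exists_corner {ι : Type*} (A : ι → Set (ℝ × ℝ)) (hA : ∀ i, Convex ℝ (A i))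
    (hK : IsCompact (⋂ i, A i)) {g : ℝ × ℝ} (hg : InRectHull (⋂ i, A i) g) :
    ∃ δ σ τ : ℝ, 0 ≤ δ ∧ (σ = 1 ∨ σ = -1) ∧ (τ = 1 ∨ τ = -1) ∧
      (g.1 + δ * σ, g.2 + δ * τ) ∈ ⋂ i, A i ∧
      ∀ r, 0 < r → r < δ → ∃ i, ∃ a b : ℝ, 0 < a ∧ 0 < b ∧ a + b = 1 ∧
        ∀ u ∈ A i, r ≤ a * (σ * (u.1 - g.1)) + b * (τ * (u.2 - g.2)) := by
  set K := ⋂ i, A i with hKdef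
  have hne : K.Nonempty := let ⟨u, hu, _⟩ := hg.1; ⟨u, hu⟩
  have hKA : ∀ i, K ⊆ A i := fun i => Set.iInter_subset A i
  obtain ⟨k, hk, hkd⟩ := hK.exists_infDist_eq_dist hne g
  have hmin : ∀ u ∈ K, dist k g ≤ dist u g := by
    intro u hu
    rw [dist_comm k, dist_comm u, ← hkd]
    exact Metric.infDist_le_dist_of_mem hu
  rcases (dist_nonneg (x := k) (y := g)).eq_or_lt with h0 | hδ
  · rw [eq_comm, dist_eq_zero] at h0
    refine ⟨0, 1, 1, le_rfl, Or.inl rfl, Or.inl rfl, by simpa [← h0] using hk, ?_⟩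
    intro r hr hr'
    linarith
  set δ := dist k g with hδdef
  obtain ⟨p, q, hpq, hsep⟩ := exists_separation (convex_iInter hA) hne hδ hmin
  obtain ⟨σ, hσ, hp⟩ := exists_sign p
  obtain ⟨τ, hτ, hq⟩ := exists_sign q
  obtain ⟨L, hL, hL1⟩ := hg.exists_mul_fst σ
  obtain ⟨D, hD, hD2⟩ := hg.exists_mul_snd τ
  have hsep' : ∀ u ∈ K, (|p| + |q|) * δ ≤ |p| * (σ * (u.1 - g.1)) + |q| * (τ * (u.2 - g.2)) := by
    intro u hu
    have h := hsep u hu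
    calc _ ≤ p * (u.1 - g.1) + q * (u.2 - g.2) := h
      _ = (|p| * σ) * (u.1 - g.1) + (|q| * τ) * (u.2 - g.2) := by rw [← hp, ← hq]
      _ = _ := by ring
  have hδ' : 0 < (|p| + |q|) * δ := mul_pos hpq hδ
  -- The supporting line is oblique: with a zero coefficient, `D` or `L` would lie on the wrong side
  -- of it.
  have hp0 : 0 < |p| := by
    refine (abs_nonneg p).lt_of_ne fun h => ?_
    have := hsep' D hD
    rw [← h] at this hδ'
    nlinarith [mul_nonneg (abs_nonneg q) (neg_nonneg.2 hD2)]
  have hq0 : 0 < |q| := by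
    refine (abs_nonneg q).lt_of_ne fun h => ?_
    have := hsep' L hL
    rw [← h] at this hδ'
    nlinarith [mul_nonneg (abs_nonneg p) (neg_nonneg.2 hL1)]
  have hLδ : δ ≤ τ * (L.2 - g.2) := by
    have := hsep' L hL
    by_contra hcon
    nlinarith [mul_nonneg (abs_nonneg p) (neg_nonneg.2 hL1), mul_pos hp0 hδ]
  have hDδ : δ ≤ σ * (D.1 - g.1) := by
    have := hsep' D hD
    by_contra hcon
    nlinarith [mul_nonneg (abs_nonneg q) (neg_nonneg.2 hD2), mul_pos hq0 hδ]
  -- An oblique supporting line touches the closed square only at one corner.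
  have hk1 : σ * (k.1 - g.1) = δ ∧ τ * (k.2 - g.2) = δ := by
    obtain ⟨h1, h2⟩ := abs_sub_le_of_dist_le hδdef.ge
    have h1' := sign_mul_le hσ h1
    have h2' := sign_mul_le hτ h2
    have := hsep' k hk
    constructor
    · refine le_antisymm h1' ?_
      by_contra hcon
      nlinarith
    · refine le_antisymm h2' ?_
      by_contra hcon
      nlinarith
  have hσ2 : σ * σ = 1 := by rcases hσ with h | h <;> rw [h] <;> norm_num
  have hτ2 : τ * τ = 1 := by rcases hτ with h | h <;> rw [h] <;> norm_num
  have hσ0 : σ ≠ 0 := by rintro rfl; norm_num at hσ2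
  have hτ0 : τ ≠ 0 := by rintro rfl; norm_num at hτ2
  have hkc : (g.1 + δ * σ, g.2 + δ * τ) = k := by
    ext
    · calc g.1 + δ * σ = g.1 + (σ * (k.1 - g.1)) * σ := by rw [hk1.1]
        _ = g.1 + (σ * σ) * (k.1 - g.1) := by ring
        _ = k.1 := by rw [hσ2]; ring
    · calc g.2 + δ * τ = g.2 + (τ * (k.2 - g.2)) * τ := by rw [hk1.2]
        _ = g.2 + (τ * τ) * (k.2 - g.2) := by ring
        _ = k.2 := by rw [hτ2]; ring
  refine ⟨δ, σ, τ, hδ.le, hσ, hτ, by rwa [hkc], fun r hr hrδ => ?_⟩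
  -- If every `A i` met the open square of radius `r`, then by `corner_mem`, with `L` and `D` common
  -- to all `A i`, the corner `g + r (σ, τ)` would lie in `K`, yet it is nearer to `g` than `δ`.
  obtain ⟨i, hi⟩ : ∃ i, ∀ u ∈ A i, r ≤ dist u g := by
    by_contra! hcon
    have hc : (g.1 + r * σ, g.2 + r * τ) ∈ K := by
      refine Set.mem_iInter.2 fun i => ?_
      obtain ⟨s, hs, hsr⟩ := hcon i
      obtain ⟨h1, h2⟩ := abs_sub_le_of_dist_le hsr.le
      have h1' := sign_mul_le hσ h1
      have h2' := sign_mul_le hτ h2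
      have e1 : ∀ t : ℝ, σ * (t - (g.1 + r * σ)) = σ * (t - g.1) - r := by
        intro t
        linear_combination (-r) * hσ2
      have e2 : ∀ t : ℝ, τ * (t - (g.2 + r * τ)) = τ * (t - g.2) - r := by
        intro t
        linear_combination (-r) * hτ2
      refine corner_mem (hA i) hs (hKA i hL) (hKA i hD) hσ0 hτ0 hp0 hq0 ?_ ?_ ?_ ?_ ?_ ?_ <;>
        simp only [e1, e2]
      · linarith
      · linarith
      · linarith
      · linarith
      · nlinarith [hsep' L hL]
      · nlinarith [hsep' D hD]
    have := hsep' _ hc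
    simp only [add_sub_cancel_left] at this
    have e : |p| * (σ * (r * σ)) + |q| * (τ * (r * τ)) = (|p| + |q|) * r := by
      linear_combination (|p| * r) * hσ2 + (|q| * r) * hτ2
    rw [e] at this
    nlinarith
  obtain ⟨p', q', hpq', hs⟩ := exists_separation (hA i) ⟨k, hKA i hk⟩ hr hi
  have hr' : 0 < (|p'| + |q'|) * r := mul_pos hpq' hr
  have hs' : ∀ u ∈ A i, (|p'| + |q'|) * r
      ≤ (p' * σ) * (σ * (u.1 - g.1)) + (q' * τ) * (τ * (u.2 - g.2)) := by
    intro u hu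
    have e : (p' * σ) * (σ * (u.1 - g.1)) + (q' * τ) * (τ * (u.2 - g.2))
      = p' * (u.1 - g.1) + q' * (u.2 - g.2) := by
      linear_combination (p' * (u.1 - g.1)) * hσ2 + (q' * (u.2 - g.2)) * hτ2
    rw [e]
    exact hs u hu
  have habs : |p'| = |p' * σ| ∧ |q'| = |q' * τ| := by
    constructor
    · rcases hσ with h | h <;> simp [h]
    · rcases hτ with h | h <;> simp [h]
  rw [habs.1, habs.2] at hs' hr'
  set a := p' * σ
  set b := q' * τ
  -- The functional separating `A i` must point to the same quadrant as the one for `K`, since `k`,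
  -- `D` and `L` belong to `A i`.
  have hsum : 0 < a + b := by
    have := hs' k (hKA i hk)
    rw [hk1.1, hk1.2] at this
    exact pos_of_mul_pos_left (a := a + b) (b := δ) (by linarith) hδ.le
  have ha : 0 < a := by
    by_contra hcon
    have := hs' D (hKA i hD)
    have hb : 0 < b := by linarith
    nlinarith [mul_nonneg hb.le (neg_nonneg.2 hD2), mul_nonneg (neg_nonneg.2 (not_lt.1 hcon)) (hδ.le.trans hDδ)]
  have hb : 0 < b := by
    by_contra hcon
    have := hs' L (hKA i hL)
    nlinarith [mul_nonneg ha.le (neg_nonneg.2 hL1), mul_nonneg (neg_nonneg.2 (not_lt.1 hcon)) (hδ.le.trans hLδ)]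
  rw [abs_of_pos ha, abs_of_pos hb] at hs'
  refine ⟨i, a / (a + b), b / (a + b), by positivity, by positivity, by field_simp, fun u hu => ?_⟩
  have e : a / (a + b) * (σ * (u.1 - g.1)) + b / (a + b) * (τ * (u.2 - g.2))
      = (a * (σ * (u.1 - g.1)) + b * (τ * (u.2 - g.2))) / (a + b) := by ring
  rw [e, le_div_iff₀ hsum]
  linarith [hs' u hu]

/-! ### Comparison of corners at two points. -/

/-- The defining property of the corner `g + δ (σ, τ)` at one point `x`, as it is seen from the sets
`K` at `x` and `K'` at another point, whose distance is controlled by `D`. -/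
def CornerBound (K K' : Set (ℝ × ℝ)) (g g' : ℝ × ℝ) (δ σ τ D : ℝ) : Prop :=
  ∀ r, 0 < r → r < δ → ∃ a b : ℝ, 0 < a ∧ 0 < b ∧ a + b = 1 ∧
    (∀ u ∈ K, r ≤ a * (σ * (u.1 - g.1)) + b * (τ * (u.2 - g.2))) ∧
    ∀ u ∈ K', r - D ≤ a * (σ * (u.1 - g'.1)) + b * (τ * (u.2 - g'.2))

/-- Test the functional at the other corner, where a convex combination of signed coordinates is at
most `δ'`. -/
theorem CornerBound.le_add {K K' : Set (ℝ × ℝ)} {g g' : ℝ × ℝ} {δ σ τ D δ' σ' τ' : ℝ}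
    (h : CornerBound K K' g g' δ σ τ D) (hσ : σ = 1 ∨ σ = -1) (hτ : τ = 1 ∨ τ = -1)
    (hσ' : σ' = 1 ∨ σ' = -1) (hτ' : τ' = 1 ∨ τ' = -1) (hD : 0 ≤ D) (hδ' : 0 ≤ δ')
    (hk : (g'.1 + δ' * σ', g'.2 + δ' * τ') ∈ K') : δ ≤ δ' + D := by
  refine le_of_forall_lt_imp_le_of_dense fun r hr => ?_
  rcases le_or_gt r 0 with h0 | h0
  · linarith
  obtain ⟨a, b, ha, hb, hab, -, h2⟩ := h r h0 hr
  have := h2 _ hk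
  simp only [add_sub_cancel_left] at this
  have e1 : σ * (δ' * σ') ≤ δ' := by
    rcases hσ with rfl | rfl <;> rcases hσ' with rfl | rfl <;> linarith
  have e2 : τ * (δ' * τ') ≤ δ' := by
    rcases hτ with rfl | rfl <;> rcases hτ' with rfl | rfl <;> linarith
  nlinarith

/-- Corners in different quadrants force both distances to be small. -/
theorem CornerBound.add_le {K K' : Set (ℝ × ℝ)} {g g' : ℝ × ℝ} {δ σ τ D δ' σ' τ' : ℝ}
    (h : CornerBound K K' g g' δ σ τ D) (h' : CornerBound K' K g' g δ' σ' τ' D)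
    (hg : ∀ t : ℝ, ∃ u ∈ K, t * (u.2 - g.2) ≤ 0) (hg' : ∀ t : ℝ, ∃ u ∈ K', t * (u.2 - g'.2) ≤ 0)
    (hσ : σ = 1 ∨ σ = -1) (hσσ' : σ' = -σ) (hτ : τ = 1 ∨ τ = -1) (hτ' : τ' = 1 ∨ τ' = -1)
    (hδ : 0 < δ) (hδ' : 0 < δ')
    (hk : (g'.1 + δ' * σ', g'.2 + δ' * τ') ∈ K') : δ + δ' ≤ D := by
  have key : ∀ r, 0 < r → r < δ → ∀ r', 0 < r' → r' < δ' → r + r' ≤ D := by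
    intro r hr hrδ r' hr' hrδ'
    obtain ⟨a, b, ha, hb, hab, h1, h2⟩ := h r hr hrδ
    obtain ⟨a', b', ha', hb', hab', h1', h2'⟩ := h' r' hr' hrδ'
    by_cases hττ : τ' = τ
    · subst hττ
      subst hσσ'
      obtain ⟨u, hu, hu'⟩ := hg τ'
      obtain ⟨v, hv, hv'⟩ := hg' τ'
      -- Weighting the two functionals by `a'` and `a` cancels the first coordinate, where the signs
      -- are opposite. The remaining second coordinate is nonpositive at `u` and at `v`.
      have A1 := mul_le_mul_of_nonneg_left (h1 u hu) ha'.le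
      have A2 := mul_le_mul_of_nonneg_left (h2' u hu) ha.le
      have B1 := mul_le_mul_of_nonneg_left (h2 v hv) ha'.le
      have B2 := mul_le_mul_of_nonneg_left (h1' v hv) ha.le
      have P : 0 ≤ a' * b + a * b' := by positivity
      have P1 := mul_nonneg P (neg_nonneg.2 hu')
      have P2 := mul_nonneg P (neg_nonneg.2 hv')
      have C1 : a' * r + a * (r' - D) ≤ 0 := by nlinarith
      have C2 : a' * (r - D) + a * r' ≤ 0 := by nlinarith
      rcases le_total a a' with hle | hle
      · have : a * (r + r' - D) ≤ 0 := by nlinarith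
        by_contra hcon
        nlinarith
      · have : a' * (r + r' - D) ≤ 0 := by nlinarith
        by_contra hcon
        nlinarith
    · have hτ2 : τ * τ' = -1 := by
        rcases hτ with rfl | rfl <;> rcases hτ' with rfl | rfl <;> simp_all
      have hσ2 : σ * σ' = -1 := by
        subst hσσ'
        rcases hσ with rfl | rfl <;> norm_num
      -- For opposite quadrants the functional takes the value `-δ'` at the other corner.
      have := h2 _ hk
      simp only [add_sub_cancel_left] at this
      have e : a * (σ * (δ' * σ')) + b * (τ * (δ' * τ')) = -δ' := by
        linear_combination a * δ' * hσ2 + b * δ' * hτ2 - δ' * hab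
      linarith
  have h1 : ∀ r, 0 < r → r < δ → r + δ' ≤ D := by
    intro r hr hrδ
    have : δ' ≤ D - r := le_of_forall_pos_lt hδ' fun r' h1 h2 => by
      linarith [key r hr hrδ r' h1 h2]
    linarith
  have : δ ≤ D - δ' := le_of_forall_pos_lt hδ fun r h1' h2 => by
    linarith [h1 r h1' h2]
  linarith

/-! ### Neighbourhoods and the refined map. -/

/-- The `r`-neighbourhood `S + r B` of a set, with `r ∈ [0, ∞]`. -/
abbrev nbhd (S : Set (ℝ × ℝ)) (r : ℝ≥0∞) : Set (ℝ × ℝ) := S + unitBallMul (ℝ × ℝ) r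

theorem mem_add_unitBallMul {E : Type*} [NormedAddCommGroup E] {S : Set E} {r : ℝ≥0∞} {u : E} :
    u ∈ S + unitBallMul E r ↔ ∃ v ∈ S, edist u v ≤ r := by
  rw [Set.mem_add]
  constructor
  · rintro ⟨v, hv, w, hw, rfl⟩
    refine ⟨v, hv, ?_⟩
    rw [unitBallMul, Metric.mem_closedEBall] at hw
    rwa [edist_eq_enorm_sub, add_sub_cancel_left, ← edist_zero_right]
  · rintro ⟨v, hv, h⟩
    refine ⟨v, hv, u - v, ?_, by abel⟩
    rw [unitBallMul, Metric.mem_closedEBall, edist_zero_right, ← edist_eq_enorm_sub]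
    exact h

theorem nbhd_zero (S : Set (ℝ × ℝ)) : nbhd S 0 = S := by
  ext u
  simp [mem_add_unitBallMul]

theorem dist_le_toReal {E : Type*} [PseudoMetricSpace E] {u v : E} {r : ℝ≥0∞} (hr : r ≠ ⊤)
    (h : edist u v ≤ r) : dist u v ≤ r.toReal := by
  rw [← ENNReal.ofReal_toReal hr] at h
  exact (edist_le_ofReal ENNReal.toReal_nonneg).1 h

theorem convex_nbhd {S : Set (ℝ × ℝ)} (hS : Convex ℝ S) (r : ℝ≥0∞) : Convex ℝ (nbhd S r) :=
  hS.add (convex_closedEBall 0 r)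

theorem isClosed_nbhd {S : Set (ℝ × ℝ)} (hS : IsCompact S) (r : ℝ≥0∞) : IsClosed (nbhd S r) :=
  Metric.isClosed_closedEBall.add_left_of_isCompact hS

theorem exists_edist_edist_le {E : Type*} [SeminormedAddCommGroup E] [NormedSpace ℝ E] {p q : E}
    {r s : ℝ≥0∞} (h : edist p q ≤ r + s) : ∃ u, edist u q ≤ r ∧ edist u p ≤ s := by
  by_cases hr : r = ⊤
  · exact ⟨p, by simp [hr], by simp⟩
  by_cases hs : s = ⊤
  · exact ⟨q, by simp, by simp [hs]⟩
  have h' := dist_le_toReal (ENNReal.add_ne_top.2 ⟨hr, hs⟩) h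
  rw [ENNReal.toReal_add hr hs] at h'
  obtain ⟨u, h1, h2⟩ := exists_dist_le_le (x := q) (z := p) ENNReal.toReal_nonneg
    ENNReal.toReal_nonneg (by rw [dist_comm]; linarith : dist q p ≤ s.toReal + r.toReal)
  refine ⟨u, ?_, ?_⟩
  · rw [← ENNReal.ofReal_toReal hr, edist_comm]
    exact (edist_le_ofReal ENNReal.toReal_nonneg).2 h1
  · rw [← ENNReal.ofReal_toReal hs]
    exact (edist_le_ofReal ENNReal.toReal_nonneg).2 h2

/-- The hypothesis of the criterion, written with points. -/
def PairCriterion {M E : Type*} [PseudoEMetricSpace E] (d : M → M → ℝ≥0∞) (F : M → Set E) : Prop :=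
  ∀ x, ∃ p, ∀ z z', ∃ q ∈ F z, ∃ q' ∈ F z', edist q q' ≤ d z' z ∧ edist p q ≤ d x z

/-- The intersection of the neighbourhoods of the sets `F z` of radii `3 d(x, z)`. -/
def refinement {M : Type*} (d : M → M → ℝ≥0∞) (F : M → Set (ℝ × ℝ)) (x : M) : Set (ℝ × ℝ) :=
  ⋂ z, nbhd (F z) (3 * d x z)

theorem refinement_subset {M : Type*} {d : M → M → ℝ≥0∞} (d_self : ∀ x, d x x = 0)
    {F : M → Set (ℝ × ℝ)} (x : M) : refinement d F x ⊆ F x := by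
  have h : refinement d F x ⊆ nbhd (F x) (3 * d x x) := Set.iInter_subset _ x
  rwa [d_self, mul_zero, nbhd_zero] at h

theorem isCompact_refinement {M : Type*} {d : M → M → ℝ≥0∞} (d_self : ∀ x, d x x = 0)
    {F : M → Set (ℝ × ℝ)} (hF : ∀ x, IsCompact (F x)) (x : M) : IsCompact (refinement d F x) :=
  (hF x).of_isClosed_subset (isClosed_iInter fun z => isClosed_nbhd (hF z) _)
    (refinement_subset d_self x)

/-- A point in the criterion for `y` is, up to `d(x, y)`, a point of the intersection of two
neighbourhoods used in the refinement at `x`. -/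
theorem exists_mem_nbhd_inter {M : Type*} {d : M → M → ℝ≥0∞} (d_comm : ∀ x y, d x y = d y x)
    (d_tri : ∀ x y z, d x z ≤ d x y + d y z) {F : M → Set (ℝ × ℝ)} {x y z z' : M} {p : ℝ × ℝ}
    (hp : ∀ z z', ∃ q ∈ F z, ∃ q' ∈ F z', edist q q' ≤ d z' z ∧ edist p q ≤ d y z) :
    ∃ u, u ∈ nbhd (F z) (3 * d x z) ∧ u ∈ nbhd (F z') (3 * d x z') ∧ edist u p ≤ d x y := by
  -- The point `u` is taken close to the set of the nearer index `z`. The other set is then reached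
  -- through `d(z', z) ≤ 2 d(x, z')`, whence the radius factor 3.
  wlog hle : d x z ≤ d x z' generalizing z z'
  · obtain ⟨u, h1, h2, h3⟩ := this (le_of_not_ge hle)
    exact ⟨u, h2, h1, h3⟩
  obtain ⟨q, hq, q', hq', hqq', hpq⟩ := hp z z'
  obtain ⟨u, hu1, hu2⟩ := exists_edist_edist_le (r := d x z) (s := d x y)
    (hpq.trans (by rw [add_comm, d_comm x y]; exact d_tri y x z))
  refine ⟨u, mem_add_unitBallMul.2 ⟨q, hq, hu1.trans ?_⟩,
    mem_add_unitBallMul.2 ⟨q', hq', ?_⟩, hu2⟩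
  · calc d x z = 1 * d x z := (one_mul _).symm
      _ ≤ 3 * d x z := by gcongr; norm_num
  · calc edist u q' ≤ edist u q + edist q q' := edist_triangle _ _ _
      _ ≤ d x z' + (d x z' + d x z') := by
          refine add_le_add (hu1.trans hle) (hqq'.trans ?_)
          calc d z' z ≤ d z' x + d x z := d_tri _ _ _
            _ ≤ d x z' + d x z' := by rw [d_comm z' x]; gcongr
      _ = 3 * d x z' := by ring

theorem mem_refinement_of_criterion {M : Type*} {d : M → M → ℝ≥0∞} {F : M → Set (ℝ × ℝ)} {x : M}
    {p : ℝ × ℝ} (hp : ∀ z z', ∃ q ∈ F z, ∃ q' ∈ F z', edist q q' ≤ d z' z ∧ edist p q ≤ d x z) :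
    p ∈ refinement d F x := by
  refine Set.mem_iInter.2 fun z => ?_
  obtain ⟨q, hq, -, -, -, hpq⟩ := hp z z
  refine mem_add_unitBallMul.2 ⟨q, hq, hpq.trans ?_⟩
  calc d x z = 1 * d x z := (one_mul _).symm
    _ ≤ 3 * d x z := by gcongr; norm_num

/-- Helly's theorem with the strip around `φ p` as the extra set; `exists_mem_nbhd_inter` supplies
the pairwise hypothesis. -/
theorem exists_refinement_near {M : Type*} {d : M → M → ℝ≥0∞} (d_self : ∀ x, d x x = 0)
    (d_comm : ∀ x y, d x y = d y x) (d_tri : ∀ x y z, d x z ≤ d x y + d y z)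
    {F : M → Set (ℝ × ℝ)} (hF : ∀ x, IsCompact (F x)) (hc : ∀ x, Convex ℝ (F x)) {x y : M}
    {p : ℝ × ℝ} (hp : ∀ z z', ∃ q ∈ F z, ∃ q' ∈ F z', edist q q' ≤ d z' z ∧ edist p q ≤ d y z)
    (hne : (refinement d F x).Nonempty) (hxy : d x y ≠ ⊤) (φ : ℝ × ℝ →L[ℝ] ℝ)
    (hφ : ∀ u v, |φ u - φ v| ≤ dist u v) :
    ∃ u ∈ refinement d F x, |φ u - φ p| ≤ (d x y).toReal := by
  have hS : {u | |φ u - φ p| ≤ (d x y).toReal} = φ ⁻¹' Metric.closedBall (φ p) (d x y).toReal := by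
    ext u
    simp [Real.dist_eq]
  obtain ⟨u, hu, hu'⟩ := inter_iInter_nonempty_of_helly (fun z => nbhd (F z) (3 * d x z))
    {u | |φ u - φ p| ≤ (d x y).toReal} (fun z => convex_nbhd (hc z) _)
    (fun z => isClosed_nbhd (hF z) _) x (by simpa only [d_self, mul_zero, nbhd_zero] using hF x)
    (by rw [hS]; exact (convex_closedBall _ _).linear_preimage φ.toLinearMap)
    (by rw [hS]; exact Metric.isClosed_closedBall.preimage φ.continuous) hne
    (fun z z' => by
      obtain ⟨u, h1, h2, h3⟩ := exists_mem_nbhd_inter (x := x) (z := z) (z' := z') d_comm d_tri hp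
      exact ⟨u, ⟨h1, h2⟩, (hφ u p).trans (dist_le_toReal hxy h3)⟩)
  exact ⟨u, hu', hu⟩

/-! ### Selection in the plane with the uniform norm. -/

theorem exists_coordinate_selection {M : Type*} {d : M → M → ℝ≥0∞} (d_self : ∀ x, d x x = 0)
    (d_comm : ∀ x y, d x y = d y x) (d_tri : ∀ x y z, d x z ≤ d x y + d y z)
    {F : M → Set (ℝ × ℝ)} (hF : ∀ x, IsCompact (F x)) (hc : ∀ x, Convex ℝ (F x))
    (hp : PairCriterion d F) (φ : ℝ × ℝ →L[ℝ] ℝ) (hφ : ∀ u v, |φ u - φ v| ≤ dist u v) :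
    ∃ g : M → ℝ, (∀ x, ∃ u ∈ refinement d F x, φ u ≤ g x) ∧
      (∀ x, ∃ u ∈ refinement d F x, g x ≤ φ u) ∧
      ∀ x y, d x y ≠ ⊤ → |g x - g y| ≤ (d x y).toReal := by
  choose p hp using hp
  have hmem := fun x => mem_refinement_of_criterion (hp x)
  have hmin := fun x => (isCompact_refinement d_self hF x).exists_isMinOn ⟨p x, hmem x⟩
    φ.continuous.continuousOn
  have hmax := fun x => (isCompact_refinement d_self hF x).exists_isMaxOn ⟨p x, hmem x⟩
    φ.continuous.continuousOn
  choose a ha ha' using hmin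
  choose b hb hb' using hmax
  -- The minimum of `φ` at `y` is at most its value at a point of the refinement near `p x`, and `φ
  -- (p x)` is at most the maximum at `x`.
  obtain ⟨g, h1, h2, h3⟩ := exists_interval_selection d d_self d_comm d_tri (fun x => φ (a x))
    (fun x => φ (b x)) (fun x y hxy => by
      obtain ⟨u, hu, hu'⟩ := exists_refinement_near d_self d_comm d_tri hF hc (hp x)
        ⟨p y, hmem y⟩ (by rwa [d_comm]) φ hφ
      have e1 : φ (a y) ≤ φ u := ha' y hu
      have e2 : φ (p x) ≤ φ (b x) := hb' x (hmem x)
      rw [d_comm y x] at hu'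
      linarith [(abs_le.1 hu').2])
  exact ⟨g, fun x => ⟨a x, ha x, h1 x⟩, fun x => ⟨b x, hb x, h2 x⟩, h3⟩

/-- The loss is 3 for the change of radius from `3 d(x, z)` to `3 d(y, z)`, plus 1 for the change
from `g` to `g'`. -/
theorem cornerBound_of_nbhd {M : Type*} {d : M → M → ℝ≥0∞}
    (d_comm : ∀ x y, d x y = d y x) (d_tri : ∀ x y z, d x z ≤ d x y + d y z)
    {F : M → Set (ℝ × ℝ)} {x y : M} (hxy : d x y ≠ ⊤) {g g' : ℝ × ℝ}
    (hg1 : |g.1 - g'.1| ≤ (d x y).toReal) (hg2 : |g.2 - g'.2| ≤ (d x y).toReal) {δ σ τ : ℝ}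
    (hσ : σ = 1 ∨ σ = -1) (hτ : τ = 1 ∨ τ = -1) (hne : ∀ z, (F z).Nonempty)
    (h : ∀ r, 0 < r → r < δ → ∃ z, ∃ a b : ℝ, 0 < a ∧ 0 < b ∧ a + b = 1 ∧
      ∀ u ∈ nbhd (F z) (3 * d x z), r ≤ a * (σ * (u.1 - g.1)) + b * (τ * (u.2 - g.2))) :
    CornerBound (refinement d F x) (refinement d F y) g g' δ σ τ (4 * (d x y).toReal) := by
  intro r hr hrδ
  obtain ⟨z, a, b, ha, hb, hab, hz⟩ := h r hr hrδ
  refine ⟨a, b, ha, hb, hab, fun u hu => hz u (Set.mem_iInter.1 hu z), fun u hu => ?_⟩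
  have hxz : d x z ≠ ⊤ := by
    -- An infinite radius would make the neighbourhood the whole plane, including `g`, where the
    -- functional vanishes.
    intro htop
    obtain ⟨v, hv⟩ := hne z
    have := hz g (mem_add_unitBallMul.2 ⟨v, hv, by simp [htop]⟩)
    simp only [sub_self, mul_zero, add_zero] at this
    linarith
  have hle : d y z ≤ d x y + d x z := by rw [d_comm x y]; exact d_tri y x z
  have hyz : d y z ≠ ⊤ := ne_top_of_le_ne_top (ENNReal.add_ne_top.2 ⟨hxy, hxz⟩) hle
  have hle' := ENNReal.toReal_mono (ENNReal.add_ne_top.2 ⟨hxy, hxz⟩) hle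
  rw [ENNReal.toReal_add hxy hxz] at hle'
  obtain ⟨v, hv, huv⟩ := mem_add_unitBallMul.1 (Set.mem_iInter.1 hu z)
  have huv' := dist_le_toReal (ENNReal.mul_ne_top (by simp) hyz) huv
  rw [ENNReal.toReal_mul, ENNReal.toReal_ofNat] at huv'
  obtain ⟨h1, h2⟩ := abs_sub_le_of_dist_le huv'
  have hσ2 : σ * σ = 1 := by rcases hσ with h | h <;> rw [h] <;> norm_num
  have hτ2 : τ * τ = 1 := by rcases hτ with h | h <;> rw [h] <;> norm_num
  have hσa : |σ| = 1 := by rcases hσ with h | h <;> simp [h]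
  have hτa : |τ| = 1 := by rcases hτ with h | h <;> simp [h]
  set t := 3 * (d x z).toReal with ht
  have ht0 : 0 ≤ t := by positivity
  -- This point minimises the functional over the square of radius `t` around `v`.
  have hw : (v.1 - t * σ, v.2 - t * τ) ∈ nbhd (F z) (3 * d x z) := by
    refine mem_add_unitBallMul.2 ⟨v, hv, ?_⟩
    have e : (3 * d x z) = ENNReal.ofReal t := by
      rw [ht, ENNReal.ofReal_mul (by norm_num), ENNReal.ofReal_toReal hxz]; norm_num
    rw [e, edist_le_ofReal ht0, Prod.dist_eq, Real.dist_eq, Real.dist_eq]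
    simp [abs_mul, hσa, hτa, abs_of_nonneg ht0]
  have hr' := hz _ hw
  simp only at hr'
  have s1 := sign_mul_le hσ ((abs_sub_comm _ _).trans_le h1)
  have s2 := sign_mul_le hτ ((abs_sub_comm _ _).trans_le h2)
  have s3 := sign_mul_le hσ ((abs_sub_comm _ _).trans_le hg1)
  have s4 := sign_mul_le hτ ((abs_sub_comm _ _).trans_le hg2)
  have e1 : σ * (v.1 - t * σ - g.1) = σ * (u.1 - g'.1) + σ * (v.1 - u.1) + σ * (g'.1 - g.1) - t := by
    linear_combination (-t) * hσ2
  have e2 : τ * (v.2 - t * τ - g.2) = τ * (u.2 - g'.2) + τ * (v.2 - u.2) + τ * (g'.2 - g.2) - t := by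
    linear_combination (-t) * hτ2
  rw [e1, e2] at hr'
  have f1 : σ * (v.1 - u.1) + σ * (g'.1 - g.1) - t ≤ 4 * (d x y).toReal := by linarith
  have f2 : τ * (v.2 - u.2) + τ * (g'.2 - g.2) - t ≤ 4 * (d x y).toReal := by linarith
  have f1' := mul_le_mul_of_nonneg_left f1 ha.le
  have f2' := mul_le_mul_of_nonneg_left f2 hb.le
  have f3 : a * (4 * (d x y).toReal) + b * (4 * (d x y).toReal) = 4 * (d x y).toReal := by
    rw [← add_mul, hab, one_mul]
  linarith

/-- Two signed distances controlled by `CornerBound` differ by at most `D`. -/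
theorem CornerBound.abs_sub_le {K K' : Set (ℝ × ℝ)} {g g' : ℝ × ℝ} {δ σ τ D δ' σ' τ' : ℝ}
    (h : CornerBound K K' g g' δ σ τ D) (h' : CornerBound K' K g' g δ' σ' τ' D)
    (hg : ∀ t : ℝ, ∃ u ∈ K, t * (u.2 - g.2) ≤ 0) (hg' : ∀ t : ℝ, ∃ u ∈ K', t * (u.2 - g'.2) ≤ 0)
    (hσ : σ = 1 ∨ σ = -1) (hσ' : σ' = 1 ∨ σ' = -1) (hτ : τ = 1 ∨ τ = -1)
    (hτ' : τ' = 1 ∨ τ' = -1) (hδ : 0 ≤ δ) (hδ' : 0 ≤ δ') (hD : 0 ≤ D)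
    (hk : (g.1 + δ * σ, g.2 + δ * τ) ∈ K) (hk' : (g'.1 + δ' * σ', g'.2 + δ' * τ') ∈ K') :
    |δ * σ - δ' * σ'| ≤ D := by
  have h1 := h.le_add hσ hτ hσ' hτ' hD hδ' hk'
  have h2 := h'.le_add hσ' hτ' hσ hτ hD hδ hk
  by_cases hs : σ' = σ
  · rw [hs, ← sub_mul, abs_mul, show |σ| = 1 by rcases hσ with h | h <;> simp [h], mul_one, abs_le]
    constructor <;> linarith
  · have hs' : σ' = -σ := by
      rcases hσ with rfl | rfl <;> rcases hσ' with rfl | rfl <;> simp_all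
    rw [hs', show δ * σ - δ' * -σ = (δ + δ') * σ by ring, abs_mul,
      show |σ| = 1 by rcases hσ with h | h <;> simp [h], mul_one, abs_of_nonneg (by linarith)]
    rcases hδ.eq_or_lt with h0 | h0
    · linarith
    rcases hδ'.eq_or_lt with h0' | h0'
    · linarith
    exact h.add_le h' hg hg' hσ hs' hτ hτ' h0 h0' hk'

theorem CornerBound.swap {K K' : Set (ℝ × ℝ)} {g g' : ℝ × ℝ} {δ σ τ D : ℝ}
    (h : CornerBound K K' g g' δ σ τ D) :
    CornerBound (Prod.swap '' K) (Prod.swap '' K') g.swap g'.swap δ τ σ D := by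
  intro r hr hrδ
  obtain ⟨a, b, ha, hb, hab, h1, h2⟩ := h r hr hrδ
  refine ⟨b, a, hb, ha, by linarith, ?_, ?_⟩
  · rintro _ ⟨u, hu, rfl⟩
    rw [add_comm]
    exact h1 u hu
  · rintro _ ⟨u, hu, rfl⟩
    rw [add_comm]
    exact h2 u hu

theorem exists_selection_of_pairCriterion {M : Type*} {d : M → M → ℝ≥0∞}
    (d_self : ∀ x, d x x = 0) (d_comm : ∀ x y, d x y = d y x)
    (d_tri : ∀ x y z, d x z ≤ d x y + d y z) {F : M → Set (ℝ × ℝ)} (hF : ∀ x, IsCompact (F x))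
    (hc : ∀ x, Convex ℝ (F x)) (hp : PairCriterion d F) :
    ∃ f : M → ℝ × ℝ, (∀ x, f x ∈ F x) ∧
      ∀ x y, d x y ≠ ⊤ → dist (f x) (f y) ≤ 5 * (d x y).toReal := by
  obtain ⟨g₁, hl1, hr1, hg1⟩ := exists_coordinate_selection d_self d_comm d_tri hF hc hp
    (ContinuousLinearMap.fst ℝ ℝ ℝ) (fun u v => by
      rw [Prod.dist_eq]; exact le_max_left (dist u.1 v.1) _)
  obtain ⟨g₂, hl2, hr2, hg2⟩ := exists_coordinate_selection d_self d_comm d_tri hF hc hp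
    (ContinuousLinearMap.snd ℝ ℝ ℝ) (fun u v => by
      rw [Prod.dist_eq]; exact le_max_right _ (dist u.2 v.2))
  have hhull : ∀ x, InRectHull (refinement d F x) (g₁ x, g₂ x) :=
    fun x => ⟨hl1 x, hr1 x, hl2 x, hr2 x⟩
  have hne : ∀ x, (F x).Nonempty := fun x => by
    obtain ⟨u, hu, -⟩ := hl1 x
    exact ⟨u, refinement_subset d_self x hu⟩
  have hcorner := fun x => exists_corner (fun z => nbhd (F z) (3 * d x z))
    (fun z => convex_nbhd (hc z) _) (isCompact_refinement d_self hF x) (hhull x)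
  choose δ σ τ hδ hσ hτ hk hbd using hcorner
  have hcb : ∀ x y, d x y ≠ ⊤ → CornerBound (refinement d F x) (refinement d F y)
      (g₁ x, g₂ x) (g₁ y, g₂ y) (δ x) (σ x) (τ x) (4 * (d x y).toReal) := fun x y hxy =>
    cornerBound_of_nbhd d_comm d_tri hxy (hg1 x y hxy) (hg2 x y hxy) (hσ x) (hτ x) hne (hbd x)
  refine ⟨fun x => (g₁ x + δ x * σ x, g₂ x + δ x * τ x),
    fun x => refinement_subset d_self x (hk x), fun x y hxy => ?_⟩
  have hD : 0 ≤ 4 * (d x y).toReal := by positivity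
  have h1 := hcb x y hxy
  have h2 := hcb y x (by rwa [d_comm])
  rw [d_comm y x] at h2
  have c1 := h1.abs_sub_le h2 (hhull x).exists_mul_snd (hhull y).exists_mul_snd (hσ x) (hσ y)
    (hτ x) (hτ y) (hδ x) (hδ y) hD (hk x) (hk y)
  have c2 := h1.swap.abs_sub_le h2.swap
    (fun t => let ⟨u, hu, hu'⟩ := (hhull x).exists_mul_fst t; ⟨u.swap, ⟨u, hu, rfl⟩, hu'⟩)
    (fun t => let ⟨u, hu, hu'⟩ := (hhull y).exists_mul_fst t; ⟨u.swap, ⟨u, hu, rfl⟩, hu'⟩)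
    (hτ x) (hτ y) (hσ x) (hσ y) (hδ x) (hδ y) hD ⟨_, hk x, rfl⟩ ⟨_, hk y, rfl⟩
  have k1 := abs_le.1 c1
  have k2 := abs_le.1 c2
  have k3 := abs_le.1 (hg1 x y hxy)
  have k4 := abs_le.1 (hg2 x y hxy)
  rw [Prod.dist_eq, Real.dist_eq, Real.dist_eq, max_le_iff, abs_le, abs_le]
  refine ⟨⟨?_, ?_⟩, ⟨?_, ?_⟩⟩ <;> simp only <;> linarith [k1.1, k1.2, k2.1, k2.2]

/-! ### An Auerbach basis of a normed plane. -/

/-- A normed plane has distance at most two from the plane with the uniform norm. -/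
theorem exists_linearMap_uniform_norm (X : Type*) [NormedAddCommGroup X] [NormedSpace ℝ X]
    (hX : Module.finrank ℝ X = 2) :
    ∃ e : X →ₗ[ℝ] ℝ × ℝ, ∀ w, ‖e w‖ ≤ ‖w‖ ∧ ‖w‖ ≤ 2 * ‖e w‖ := by
  have : FiniteDimensional ℝ X := FiniteDimensional.of_finrank_pos (by omega)
  have : ProperSpace X := FiniteDimensional.proper ℝ X
  let T : X ≃L[ℝ] ℝ × ℝ := ContinuousLinearEquiv.ofFinrankEq (by simp [hX])
  -- A pair `a`, `b` of the unit ball maximising this determinant is an Auerbach basis: by Cramer's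
  -- rule the coordinates of `w` are `φ (w, b) / m` and `φ (a, w) / m`, each bounded by `‖w‖`.
  let φ : X × X → ℝ := fun v => (T v.1).1 * (T v.2).2 - (T v.1).2 * (T v.2).1
  have hφ : Continuous φ := by fun_prop
  obtain ⟨⟨a, b⟩, ⟨ha, hb⟩, hmax⟩ := ((isCompact_closedBall (0 : X) 1).prod
    (isCompact_closedBall (0 : X) 1)).exists_isMaxOn ⟨(0, 0), by simp⟩ hφ.continuousOn
  rw [mem_closedBall_zero_iff] at ha hb
  simp only at ha hb
  set m := φ (a, b) with hm
  have hmax' : ∀ u v : X, ‖u‖ ≤ 1 → ‖v‖ ≤ 1 → φ (u, v) ≤ m := fun u v hu hv =>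
    hmax (Set.mk_mem_prod (mem_closedBall_zero_iff.2 hu) (mem_closedBall_zero_iff.2 hv))
  have hbound : ∀ u v : X, φ (u, v) ≤ m * (‖u‖ * ‖v‖) := by
    intro u v
    rcases eq_or_ne u 0 with rfl | hu
    · simp [φ]
    rcases eq_or_ne v 0 with rfl | hv
    · simp [φ]
    have hu' := norm_pos_iff.2 hu
    have hv' := norm_pos_iff.2 hv
    have h := hmax' (‖u‖⁻¹ • u) (‖v‖⁻¹ • v) (by rw [norm_smul, norm_inv, norm_norm,
      inv_mul_cancel₀ hu'.ne']) (by rw [norm_smul, norm_inv, norm_norm, inv_mul_cancel₀ hv'.ne'])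
    have e : φ (‖u‖⁻¹ • u, ‖v‖⁻¹ • v) = φ (u, v) / (‖u‖ * ‖v‖) := by
      simp only [φ, map_smul, Prod.smul_fst, Prod.smul_snd, smul_eq_mul]
      field_simp
    rwa [e, div_le_iff₀ (by positivity)] at h
  have hmpos : 0 < m := by
    have h := hbound (T.symm (1, 0)) (T.symm (0, 1))
    have e : φ (T.symm (1, 0), T.symm (0, 1)) = 1 := by simp [φ]
    rw [e] at h
    by_contra hcon
    have : m * (‖T.symm (1, 0)‖ * ‖T.symm (0, 1)‖) ≤ 0 :=
      mul_nonpos_of_nonpos_of_nonneg (not_lt.1 hcon) (by positivity)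
    linarith
  have habs : ∀ u v : X, |φ (u, v)| ≤ m * (‖u‖ * ‖v‖) := by
    intro u v
    refine abs_le'.2 ⟨hbound u v, ?_⟩
    have h := hbound (-u) v
    rw [norm_neg] at h
    refine le_trans (le_of_eq ?_) h
    simp only [φ, map_neg, Prod.fst_neg, Prod.snd_neg]
    ring
  let e : X →ₗ[ℝ] ℝ × ℝ :=
    { toFun := fun w => (φ (w, b) / m, φ (a, w) / m)
      map_add' := fun u v => by
        ext <;> simp only [φ, map_add, Prod.fst_add, Prod.snd_add] <;> ring
      map_smul' := fun c u => by
        ext <;> simp only [φ, map_smul, Prod.smul_fst, Prod.smul_snd, smul_eq_mul,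
          RingHom.id_apply] <;> ring }
  have he : ∀ w, e w = (φ (w, b) / m, φ (a, w) / m) := fun w => rfl
  refine ⟨e, fun w => ⟨?_, ?_⟩⟩
  · have hw := norm_nonneg w
    rw [he, Prod.norm_def, max_le_iff, Real.norm_eq_abs, Real.norm_eq_abs, abs_div, abs_div,
      abs_of_pos hmpos, div_le_iff₀ hmpos, div_le_iff₀ hmpos]
    constructor
    · refine (habs w b).trans ?_
      rw [mul_comm ‖w‖ m]
      exact mul_le_mul_of_nonneg_left (mul_le_of_le_one_right hw hb) hmpos.le
    · refine (habs a w).trans ?_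
      rw [mul_comm ‖w‖ m]
      exact mul_le_mul_of_nonneg_left (mul_le_of_le_one_left hw ha) hmpos.le
  · have hw : w = (e w).1 • a + (e w).2 • b := by
      apply T.injective
      rw [he]
      have hm0 := hmpos.ne'
      ext
      · simp only [map_add, map_smul, Prod.fst_add, Prod.smul_fst, smul_eq_mul]
        field_simp
        simp only [hm, φ]
        ring
      · simp only [map_add, map_smul, Prod.snd_add, Prod.smul_snd, smul_eq_mul]
        field_simp
        simp only [hm, φ]
        ring
    calc ‖w‖ = ‖(e w).1 • a + (e w).2 • b‖ := by rw [← hw]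
      _ ≤ ‖(e w).1‖ * ‖a‖ + ‖(e w).2‖ * ‖b‖ := by
          rw [← norm_smul, ← norm_smul]; exact norm_add_le _ _
      _ ≤ ‖e w‖ * 1 + ‖e w‖ * 1 := by
          gcongr
          · exact norm_fst_le _
          · exact norm_snd_le _
      _ = 2 * ‖e w‖ := by ring

/-! ### Passage to the original space and the optimal constants. -/

theorem criterionSet_nonempty_iff {M X : Type*} [PseudoEMetricSpace M] [NormedAddCommGroup X]
    {F : M → Set X} {l : ℝ} : (∀ x, (criterionSet F l x).Nonempty) ↔
      PairCriterion (fun x y => ENNReal.ofReal l * edist x y) F := by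
  refine forall_congr' fun x => exists_congr fun p => ?_
  simp only [criterionSet, Set.mem_iInter, mem_add_unitBallMul, Set.mem_inter_iff]
  refine forall_congr' fun z => forall_congr' fun z' => exists_congr fun q => ?_
  constructor
  · rintro ⟨⟨hq, q', hq', h⟩, h'⟩
    exact ⟨hq, q', hq', h, h'⟩
  · rintro ⟨hq, q', hq', h, h'⟩
    exact ⟨⟨hq, q', hq', h⟩, h'⟩

theorem mem_admissibleConstants_of_selection {M X : Type*} [PseudoEMetricSpace M]
    [NormedAddCommGroup X] {F : M → Set X} {f : M → X} (hf : ∀ x, f x ∈ F x) {l : ℝ}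
    (hl : l ∈ lipConstants f) : l ∈ admissibleConstants F := by
  have h : ∀ x y, edist (f x) (f y) ≤ ENNReal.ofReal l * edist x y := fun x y => by
    rw [edist_dist, dist_eq_norm]
    exact hl.2 x y
  refine ⟨hl.1, criterionSet_nonempty_iff.2 fun x => ⟨f x, fun z z' =>
    ⟨f z, hf z, f z', hf z', ?_, h x z⟩⟩⟩
  rw [edist_comm]
  exact h z' z

/-- Since `e` is nonexpansive, the criterion passes to the images `e '' F x`. Lifting the planar
selection back costs the factor `k`. -/
theorem exists_selection_of_admissible {M X : Type*} [PseudoEMetricSpace M]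
    [NormedAddCommGroup X] [NormedSpace ℝ X] [FiniteDimensional ℝ X] (e : X →ₗ[ℝ] ℝ × ℝ) {k : ℝ}
    (hk : 0 < k) (he : ∀ w, ‖e w‖ ≤ ‖w‖ ∧ ‖w‖ ≤ k * ‖e w‖) {F : M → Set X}
    (hF : ∀ x, F x ∈ compactConvexFamily X) {l : ℝ} (hl : l ∈ admissibleConstants F) :
    ∃ f : M → X, (∀ x, f x ∈ F x) ∧ k * 5 * l ∈ lipConstants f := by
  have hl0 := hl.1
  have he' : ∀ u v, edist (e u) (e v) ≤ edist u v := fun u v => by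
    rw [edist_dist, edist_dist, dist_eq_norm, dist_eq_norm, ← map_sub]
    exact ENNReal.ofReal_le_ofReal (he _).1
  have hcrit := criterionSet_nonempty_iff.1 hl.2
  obtain ⟨f', hf', hlip⟩ := exists_selection_of_pairCriterion
    (d := fun x y : M => ENNReal.ofReal l * edist x y) (F := fun x => e '' F x)
    (by simp) (fun x y => by rw [edist_comm])
    (fun x y z => by
      rw [← mul_add]
      gcongr
      exact edist_triangle _ _ _)
    (fun x => (hF x).2.1.image e.continuous_of_finiteDimensional)
    (fun x => (hF x).2.2.1.linear_image e)
    (fun x => by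
      obtain ⟨p, hp⟩ := hcrit x
      refine ⟨e p, fun z z' => ?_⟩
      obtain ⟨q, hq, q', hq', h, h'⟩ := hp z z'
      exact ⟨e q, ⟨q, hq, rfl⟩, e q', ⟨q', hq', rfl⟩, (he' _ _).trans h, (he' _ _).trans h'⟩)
  choose f hf hfe using hf'
  refine ⟨f, hf, by positivity, fun x y => ?_⟩
  by_cases htop : edist x y = ⊤
  · rw [htop, ENNReal.mul_top (by simpa using (by positivity : 0 < k * 5 * l))]
    exact le_top
  have h := hlip x y (ENNReal.mul_ne_top ENNReal.ofReal_ne_top htop)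
  rw [← hfe, ← hfe, dist_eq_norm, ← map_sub, ENNReal.toReal_mul,
    ENNReal.toReal_ofReal hl0.le] at h
  have h2 := (he (f x - f y)).2
  rw [← ENNReal.ofReal_toReal htop, ← ENNReal.ofReal_mul (by positivity)]
  refine ENNReal.ofReal_le_ofReal ?_
  calc ‖f x - f y‖ ≤ k * ‖e (f x - f y)‖ := h2
    _ ≤ k * (5 * (l * (edist x y).toReal)) := by gcongr
    _ = k * 5 * l * (edist x y).toReal := by ring

theorem bddBelow_lipConstants {M X : Type*} [PseudoEMetricSpace M] [NormedAddCommGroup X]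
    (f : M → X) : BddBelow (lipConstants f) := ⟨0, fun _ h => h.1.le⟩

theorem lipSeminorm_nonneg {M X : Type*} [PseudoEMetricSpace M] [NormedAddCommGroup X]
    (f : M → X) : 0 ≤ lipSeminorm f := Real.sInf_nonneg fun _ h => h.1.le

theorem sInf_admissibleConstants_le_selectionNorm {M X : Type*} [PseudoEMetricSpace M]
    [NormedAddCommGroup X] {F : M → Set X} (h : ∃ f, IsLipschitzSelection F f) :
    sInf (admissibleConstants F) ≤ selectionNorm F := by
  obtain ⟨f, hf⟩ := h
  refine le_csInf ⟨_, f, hf, rfl⟩ ?_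
  rintro _ ⟨f, hf, rfl⟩
  refine le_csInf hf.2 fun l hl => csInf_le ⟨0, fun _ h => h.1.le⟩ ?_
  exact mem_admissibleConstants_of_selection hf.1 hl

theorem selectionNorm_le {M X : Type*} [PseudoEMetricSpace M] [NormedAddCommGroup X]
    {F : M → Set X} {c : ℝ} (hc : 0 < c)
    (h : ∀ l ∈ admissibleConstants F, ∃ f : M → X, (∀ x, f x ∈ F x) ∧ c * l ∈ lipConstants f)
    (hne : ∃ f, IsLipschitzSelection F f) :
    selectionNorm F ≤ c * sInf (admissibleConstants F) := by
  obtain ⟨f₀, hf₀, l₀, hl₀⟩ := hne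
  have hne' : (admissibleConstants F).Nonempty :=
    ⟨l₀, mem_admissibleConstants_of_selection hf₀ hl₀⟩
  rw [← div_le_iff₀' hc]
  refine le_csInf hne' fun l hl => ?_
  rw [div_le_iff₀' hc]
  obtain ⟨f, hf, hfl⟩ := h l hl
  calc selectionNorm F ≤ lipSeminorm f :=
        csInf_le ⟨0, by rintro _ ⟨f, -, rfl⟩; exact lipSeminorm_nonneg f⟩ ⟨f, ⟨hf, _, hfl⟩, rfl⟩
    _ ≤ c * l := csInf_le (bddBelow_lipConstants f) hfl

theorem sInf_admissibleConstants_nonneg {M X : Type*} [PseudoEMetricSpace M]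
    [NormedAddCommGroup X] (F : M → Set X) : 0 ≤ sInf (admissibleConstants F) :=
  Real.sInf_nonneg fun _ h => h.1.le

end LipSel

theorem mainTheorem7 {M : Type*} [PseudoEMetricSpace M] :
    (∀ (X : Type*) [NormedAddCommGroup X] [NormedSpace ℝ X], Module.finrank ℝ X = 2 →
      ∀ F : M → Set X, (∀ x, F x ∈ LipSel.compactConvexFamily X) →
        ((∃ f, LipSel.IsLipschitzSelection F f) ↔
          ∃ l : ℝ, 0 < l ∧ ∀ x, (LipSel.criterionSet F l x).Nonempty) ∧
        ((∃ f, LipSel.IsLipschitzSelection F f) →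
          sInf (LipSel.admissibleConstants F) ≤ LipSel.selectionNorm F ∧
          LipSel.selectionNorm F ≤ 12 * sInf (LipSel.admissibleConstants F))) ∧
    -- the space `Fin 2 → ℝ` carries the uniform norm
    (∀ F : M → Set (Fin 2 → ℝ), (∀ x, F x ∈ LipSel.compactConvexFamily (Fin 2 → ℝ)) →
      (∃ f, LipSel.IsLipschitzSelection F f) →
        sInf (LipSel.admissibleConstants F) ≤ LipSel.selectionNorm F ∧
        LipSel.selectionNorm F ≤ 8 * sInf (LipSel.admissibleConstants F)) := by
  refine ⟨fun X _ _ hX F hF => ?_, fun F hF hne => ?_⟩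
  · have : FiniteDimensional ℝ X := FiniteDimensional.of_finrank_pos (by omega)
    obtain ⟨e, he⟩ := LipSel.exists_linearMap_uniform_norm X hX
    have hsel := fun l (hl : l ∈ LipSel.admissibleConstants F) =>
      LipSel.exists_selection_of_admissible e (by norm_num) he hF hl
    refine ⟨⟨?_, ?_⟩, fun hne => ⟨LipSel.sInf_admissibleConstants_le_selectionNorm hne, ?_⟩⟩
    · rintro ⟨f, hf, l, hl⟩
      exact ⟨l, LipSel.mem_admissibleConstants_of_selection hf hl⟩
    · rintro ⟨l, hl⟩
      obtain ⟨f, hf, hfl⟩ := hsel l hl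
      exact ⟨f, hf, _, hfl⟩
    -- The construction gives 2 * 5 = 10; nonnegativity of the infimum relaxes it to 12.
    · linarith [LipSel.selectionNorm_le (by norm_num) hsel hne,
        LipSel.sInf_admissibleConstants_nonneg F]
  · let e : (Fin 2 → ℝ) →ₗ[ℝ] ℝ × ℝ :=
      (LinearMap.proj (R := ℝ) (φ := fun _ : Fin 2 => ℝ) 0).prod (LinearMap.proj 1)
    have he : ∀ w, ‖e w‖ ≤ ‖w‖ ∧ ‖w‖ ≤ 1 * ‖e w‖ := by
      intro w
      have h0 : ‖w 0‖ ≤ ‖e w‖ := norm_fst_le (e w)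
      have h1 : ‖w 1‖ ≤ ‖e w‖ := norm_snd_le (e w)
      refine ⟨?_, ?_⟩
      · exact max_le (norm_le_pi_norm w 0) (norm_le_pi_norm w 1)
      · rw [one_mul, pi_norm_le_iff_of_nonneg (norm_nonneg _), Fin.forall_fin_two]
        exact ⟨h0, h1⟩
    refine ⟨LipSel.sInf_admissibleConstants_le_selectionNorm hne, ?_⟩
    -- Here `e` is an isometry, so the constant obtained is 5, relaxed to 8.
    linarith [LipSel.selectionNorm_le (by norm_num) (fun l hl =>
      LipSel.exists_selection_of_admissible e one_pos he hF hl) hne,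
      LipSel.sInf_admissibleConstants_nonneg F]
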